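/- Let $X$ be a complex manifold. An exhaustion function of $X$ is a continuous function $\rho:X\to[0,\infty)$ all of whose sublevel sets $\{x:\rho(x)\le c\}$ are compact. An infinite discrete subset $D\subset X$ (i.e. an infinite closed subset whose induced topology is discrete) is called \emph{tame} if for every exhaustion function $\rho$ of $X$ and every map $\zeta:D\to[0,\infty)$ there exists a biholomorphic self-map $\phi$ of $X$ such that $\rho(\phi(x))\ge\zeta(x)$ for all $x\in D$. Corollary. Let $K=\mathbb{Q}$ or let $K$ be an imaginary quadratic number field, embedded in $\mathbb{C}$, and let $\mathcal{O}_K$ be its ring of algebraic integers. Then $SL_2(\mathcal{O}_K)$ is a tame discrete subset of the complex manifold $SL_2(\mathbb{C})$. In particular, $SL_2(\mathbb{Z}[i])$ is a tame discrete subset of $SL_2(\mathbb{C})$. -/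

import Mathlib

open scoped Manifold ContDiff MatrixGroups NNReal NumberField

noncomputable section

/-! ### Tame discrete subsets of a complex manifold -/

/-- An exhaustion function on a topological space: a continuous function `ρ : X → [0, ∞)` all of
whose sublevel sets are compact. -/
def IsExhaustionFunction {X : Type*} [TopologicalSpace X] (ρ : X → ℝ≥0) : Prop :=
  Continuous ρ ∧ ∀ c : ℝ≥0, IsCompact {x | ρ x ≤ c}

/-- A biholomorphic self-map (automorphism) of a complex manifold modelled on `E`: a bijection
which is holomorphic (complex differentiable in charts) together with its inverse. -/
def IsHolomorphicAutomorphism (E : Type*) [NormedAddCommGroup E] [NormedSpace ℂ E]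
    {X : Type*} [TopologicalSpace X] [ChartedSpace E X] (φ : X ≃ X) : Prop :=
  MDifferentiable 𝓘(ℂ, E) 𝓘(ℂ, E) φ ∧ MDifferentiable 𝓘(ℂ, E) 𝓘(ℂ, E) φ.symm

/-- A subset `D` of a complex manifold `X` is a (weakly) tame discrete subset if it is infinite,
discrete (closed, with discrete induced topology, i.e. without accumulation points in `X`), and
for every exhaustion function `ρ` of `X` and every function `ζ : D → [0, ∞)` there is an
automorphism `φ` of the complex manifold `X` with `ρ (φ x) ≥ ζ x` for all `x ∈ D`. -/
def IsTameDiscrete (E : Type*) [NormedAddCommGroup E] [NormedSpace ℂ E]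
    {X : Type*} [TopologicalSpace X] [ChartedSpace E X] [IsManifold 𝓘(ℂ, E) ω X]
    (D : Set X) : Prop :=
  D.Infinite ∧ IsClosed D ∧ IsDiscrete D ∧
    ∀ ρ : X → ℝ≥0, IsExhaustionFunction ρ → ∀ ζ : D → ℝ≥0,
      ∃ φ : X ≃ X, IsHolomorphicAutomorphism E φ ∧ ∀ x : D, ζ x ≤ ρ (φ x)

/-! ### The complex manifold `SL(2, ℂ)` -/

namespace SL2C

/-- On `{g | g 0 0 ≠ 0}` the entries `(g 0 0, g 1 0, g 0 1)` are coordinates; this is the inverse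
map (with a dummy value where the first coordinate vanishes). -/
def ofFirst (p : ℂ × ℂ × ℂ) : SL(2, ℂ) :=
  if h : p.1 = 0 then 1 else
    ⟨!![p.1, p.2.2; p.2.1, (1 + p.2.1 * p.2.2) / p.1], by
      rw [Matrix.det_fin_two_of]; field_simp; ring⟩

/-- On `{g | g 1 0 ≠ 0}` the entries `(g 0 0, g 1 0, g 1 1)` are coordinates; this is the inverse
map (with a dummy value where the second coordinate vanishes). -/
def ofSecond (p : ℂ × ℂ × ℂ) : SL(2, ℂ) :=
  if h : p.2.1 = 0 then 1 else
    ⟨!![p.1, (p.1 * p.2.2 - 1) / p.2.1; p.2.1, p.2.2], by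
      rw [Matrix.det_fin_two_of]; field_simp; ring⟩

theorem coe_ofFirst {p : ℂ × ℂ × ℂ} (h : p.1 ≠ 0) :
    (ofFirst p : Matrix (Fin 2) (Fin 2) ℂ) =
      !![p.1, p.2.2; p.2.1, (1 + p.2.1 * p.2.2) / p.1] := by
  simp [ofFirst, h]

theorem coe_ofSecond {p : ℂ × ℂ × ℂ} (h : p.2.1 ≠ 0) :
    (ofSecond p : Matrix (Fin 2) (Fin 2) ℂ) =
      !![p.1, (p.1 * p.2.2 - 1) / p.2.1; p.2.1, p.2.2] := by
  simp [ofSecond, h]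

theorem continuous_entry (i j : Fin 2) : Continuous fun g : SL(2, ℂ) => g i j :=
  continuous_subtype_val.matrix_elem i j

/-- The chart `g ↦ (g 0 0, g 1 0, g 0 1)` on the open set `{g | g 0 0 ≠ 0}`. -/
def chartFirst : OpenPartialHomeomorph SL(2, ℂ) (ℂ × ℂ × ℂ) where
  toFun g := (g 0 0, g 1 0, g 0 1)
  invFun := ofFirst
  source := {g | g 0 0 ≠ 0}
  target := {p | p.1 ≠ 0}
  map_source' _ h := h
  map_target' p (h : p.1 ≠ 0) := by
    simpa [coe_ofFirst h] using h
  left_inv' g (h : g 0 0 ≠ 0) := by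
    have hd := g.det_coe
    rw [Matrix.det_fin_two] at hd
    apply Subtype.ext
    rw [coe_ofFirst h]
    ext i j
    fin_cases i <;> fin_cases j <;> simp
    field_simp
    linear_combination -hd
  right_inv' p (h : p.1 ≠ 0) := by
    simp [coe_ofFirst h]
  open_source := isOpen_ne.preimage (continuous_entry 0 0)
  open_target := isOpen_ne.preimage continuous_fst
  continuousOn_toFun := by
    refine Continuous.continuousOn ?_
    exact (continuous_entry 0 0).prodMk ((continuous_entry 1 0).prodMk (continuous_entry 0 1))
  continuousOn_invFun := by
    refine Topology.IsInducing.subtypeVal.continuousOn_iff.2 ?_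
    have h : ContinuousOn (fun p : ℂ × ℂ × ℂ =>
        (!![p.1, p.2.2; p.2.1, (1 + p.2.1 * p.2.2) / p.1] : Matrix (Fin 2) (Fin 2) ℂ))
        {p | p.1 ≠ 0} := by
      refine continuousOn_pi.2 fun i => continuousOn_pi.2 fun j => ?_
      fin_cases i <;> fin_cases j <;> simp <;> fun_prop (disch := simp)
    exact h.congr fun p hp => coe_ofFirst hp

/-- The chart `g ↦ (g 0 0, g 1 0, g 1 1)` on the open set `{g | g 1 0 ≠ 0}`. -/
def chartSecond : OpenPartialHomeomorph SL(2, ℂ) (ℂ × ℂ × ℂ) where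
  toFun g := (g 0 0, g 1 0, g 1 1)
  invFun := ofSecond
  source := {g | g 1 0 ≠ 0}
  target := {p | p.2.1 ≠ 0}
  map_source' _ h := h
  map_target' p (h : p.2.1 ≠ 0) := by
    simpa [coe_ofSecond h] using h
  left_inv' g (h : g 1 0 ≠ 0) := by
    have hd := g.det_coe
    rw [Matrix.det_fin_two] at hd
    apply Subtype.ext
    rw [coe_ofSecond h]
    ext i j
    fin_cases i <;> fin_cases j <;> simp
    field_simp
    linear_combination hd
  right_inv' p (h : p.2.1 ≠ 0) := by
    simp [coe_ofSecond h]
  open_source := isOpen_ne.preimage (continuous_entry 1 0)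
  open_target := isOpen_ne.preimage (continuous_fst.comp continuous_snd)
  continuousOn_toFun := by
    refine Continuous.continuousOn ?_
    exact (continuous_entry 0 0).prodMk ((continuous_entry 1 0).prodMk (continuous_entry 1 1))
  continuousOn_invFun := by
    refine Topology.IsInducing.subtypeVal.continuousOn_iff.2 ?_
    have h : ContinuousOn (fun p : ℂ × ℂ × ℂ =>
        (!![p.1, (p.1 * p.2.2 - 1) / p.2.1; p.2.1, p.2.2] : Matrix (Fin 2) (Fin 2) ℂ))
        {p | p.2.1 ≠ 0} := by
      refine continuousOn_pi.2 fun i => continuousOn_pi.2 fun j => ?_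
      fin_cases i <;> fin_cases j <;> simp <;> fun_prop (disch := simp)
    exact h.congr fun p hp => coe_ofSecond hp

theorem mem_source_of_eq_zero (g : SL(2, ℂ)) (h : g 0 0 = 0) : g ∈ chartSecond.source := by
  have hd := g.det_coe
  rw [Matrix.det_fin_two] at hd
  intro h'
  simp [h, h'] at hd

open Classical in
/-- The atlas of `SL(2, ℂ)` consisting of the two charts above. It makes `SL(2, ℂ)` a
three-dimensional complex manifold. -/
instance : ChartedSpace (ℂ × ℂ × ℂ) SL(2, ℂ) where
  atlas := {chartFirst, chartSecond}
  chartAt g := if g 0 0 = 0 then chartSecond else chartFirst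
  mem_chart_source g := by
    split_ifs with h
    · exact mem_source_of_eq_zero g h
    · exact h
  chart_mem_atlas g := by
    split_ifs <;> simp

instance : IsManifold 𝓘(ℂ, ℂ × ℂ × ℂ) ω SL(2, ℂ) := by
  apply isManifold_of_contDiffOn
  rintro e e' (rfl | rfl) (rfl | rfl)
  · refine contDiffOn_id.congr fun p hp => ?_
    have h : p.1 ≠ 0 := by simpa [chartFirst] using hp.1.1
    exact chartFirst.right_inv' h
  · have h : ContDiffOn ℂ ω (fun p : ℂ × ℂ × ℂ => (p.1, p.2.1, (1 + p.2.1 * p.2.2) / p.1))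
        {p | p.1 ≠ 0} := by
      fun_prop (disch := simp)
    refine (h.mono ?_).congr ?_
    · intro p hp
      simpa [chartFirst] using hp.1.1
    · intro p hp
      have h : p.1 ≠ 0 := by simpa [chartFirst] using hp.1.1
      change ((ofFirst p) 0 0, (ofFirst p) 1 0, (ofFirst p) 1 1) = _
      simp [coe_ofFirst h]
  · have h : ContDiffOn ℂ ω (fun p : ℂ × ℂ × ℂ => (p.1, p.2.1, (p.1 * p.2.2 - 1) / p.2.1))
        {p | p.2.1 ≠ 0} := by
      fun_prop (disch := simp)
    refine (h.mono ?_).congr ?_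
    · intro p hp
      simpa [chartSecond] using hp.1.1
    · intro p hp
      have h : p.2.1 ≠ 0 := by simpa [chartSecond] using hp.1.1
      change ((ofSecond p) 0 0, (ofSecond p) 1 0, (ofSecond p) 0 1) = _
      simp [coe_ofSecond h]
  · refine contDiffOn_id.congr fun p hp => ?_
    have h : p.2.1 ≠ 0 := by simpa [chartSecond] using hp.1.1
    exact chartSecond.right_inv' h

end SL2C

/-- The image of `SL(2, R)` in `SL(2, ℂ)` under a ring homomorphism `σ : R → ℂ`. -/
def sl2Image {R : Type*} [CommRing R] (σ : R →+* ℂ) : Set SL(2, ℂ) :=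
  Set.range (Matrix.SpecialLinearGroup.map (n := Fin 2) σ)

end

open Filter Topology

/-! Each of the rings, embedded in `ℂ`, is a subring `S` with finitely many points in each disc, and
only this is used. Write `a, b, c, d` for the entries of a matrix over `S`, row by row. If the lower
left entry were nonzero and proper on the matrices, a row shear whose parameter is an entire
function of that entry would finish: the shear fixes the entry, each of its values is taken finitely
often, and interpolation lets the parameter be as large as needed at each value
(`exists_automorphism_le_exhaustion`).

The entry `c` itself has infinite fibres, so `exists_automorphism_proper_entry` first changes
coordinates. A column shear by an entire function of `d` equal to `1 / (2 * d)` at nonzero `d ∈ S`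
turns `c` into `c + 1/2`, which is nonzero, and mixes `b` into the upper left entry. A torus action
with parameter depending on the diagonal then multiplies the lower left entry by an exponential so
large that a bound on the product bounds the whole matrix. -/

/-- A subset of `ℂ` having only finitely many points in each bounded disc. -/
def FiniteInDiscs (S : Set ℂ) : Prop := ∀ M : ℝ, {z | z ∈ S ∧ ‖z‖ ≤ M}.Finite

/-! ### Interpolation by entire functions -/

theorem FiniteInDiscs.countable {S : Set ℂ} (hS : FiniteInDiscs S) : S.Countable := by
  refine (Set.countable_iUnion fun n : ℕ => (hS n).countable).mono fun z hz => ?_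
  obtain ⟨n, hn⟩ := exists_nat_ge ‖z‖
  exact Set.mem_iUnion.2 ⟨n, hz, hn⟩

/-- The inductive step of interpolation: the value at `p k` is corrected without disturbing earlier
nodes, by a term small enough for the series of corrections to converge uniformly on discs. -/
theorem exists_entire_correction (p : ℕ → ℂ) (hp : Function.Injective p) (k : ℕ) (c : ℂ) :
    ∃ P : ℂ → ℂ, Differentiable ℂ P ∧ (∀ j < k, P (p j) = 0) ∧ P (p k) = c ∧
      ∀ z, 2 * ‖z‖ < ‖p k‖ → ‖P z‖ ≤ (1 / 2) ^ k := by
  let Q : ℂ → ℂ := fun z => c * ∏ j ∈ Finset.range k, ((z - p j) / (p k - p j))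
  have hQ : Differentiable ℂ Q := by unfold Q; fun_prop
  have hQ0 : ∀ j < k, Q (p j) = 0 := fun j hj =>
    mul_eq_zero_of_right _ (Finset.prod_eq_zero (Finset.mem_range.2 hj) (by simp))
  have hQk : Q (p k) = c := by
    have : ∏ j ∈ Finset.range k, ((p k - p j) / (p k - p j)) = 1 := by
      refine Finset.prod_eq_one fun j hj => div_self (sub_ne_zero.2 fun h => ?_)
      exact (Finset.mem_range.1 hj).ne' (hp h)
    simp only [Q, this, mul_one]
  by_cases h0 : p k = 0
  · refine ⟨Q, hQ, hQ0, hQk, fun z hz => ?_⟩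
    rw [h0, norm_zero] at hz
    linarith [norm_nonneg z]
  obtain ⟨B, hB⟩ := (isCompact_closedBall (0 : ℂ) ‖p k‖).exists_bound_of_continuousOn
    hQ.continuous.continuousOn
  have hB0 : 0 ≤ B := (norm_nonneg _).trans (hB 0 (by simp))
  -- The factor `(z / p k) ^ N` is `1` at `p k` and at most `(1 / 2) ^ N` on the half-size disc,
  -- which beats the bound `B` of the Lagrange polynomial.
  obtain ⟨N, hN⟩ := exists_pow_lt_of_lt_one
    (show (0 : ℝ) < (1 / 2) ^ k / (B + 1) by positivity) (show (1 / 2 : ℝ) < 1 by norm_num)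
  refine ⟨fun z => (z / p k) ^ N * Q z, by fun_prop, fun j hj => ?_, ?_, fun z hz => ?_⟩
  · simp [hQ0 j hj]
  · simp [hQk, h0]
  · have hpk : 0 < ‖p k‖ := norm_pos_iff.2 h0
    have h1 : ‖z / p k‖ ≤ 1 / 2 := by
      rw [norm_div, div_le_iff₀ hpk]; linarith
    have h2 : ‖Q z‖ ≤ B := hB z (by
      rw [mem_closedBall_zero_iff]; linarith [norm_nonneg z])
    rw [norm_mul, norm_pow]
    calc ‖z / p k‖ ^ N * ‖Q z‖ ≤ (1 / 2) ^ N * B := by gcongr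
      _ ≤ (1 / 2) ^ k / (B + 1) * (B + 1) := by gcongr; linarith
      _ = (1 / 2) ^ k := by field_simp

/-- Interpolation by entire functions along a sequence tending to infinity. -/
theorem exists_entire_eq_on_sequence (p : ℕ → ℂ) (hp : Function.Injective p)
    (hinf : ∀ M : ℝ, ∀ᶠ k in atTop, M < ‖p k‖) (v : ℕ → ℂ) :
    ∃ F : ℂ → ℂ, Differentiable ℂ F ∧ ∀ k, F (p k) = v k := by
  choose P hPd hP0 hPk hPb using exists_entire_correction p hp
  let G : ℕ → ℂ → ℂ := fun n => Nat.rec 0 (fun k T z => T z + P k (v k - T (p k)) z) n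
  have hG : ∀ k z, G (k + 1) z = G k z + P k (v k - G k (p k)) z := fun _ _ => rfl
  have hGsum : ∀ n z, G n z = ∑ k ∈ Finset.range n, P k (v k - G k (p k)) z := by
    intro n z
    induction n with
    | zero => rfl
    | succ n ih => rw [hG, ih, Finset.sum_range_succ]
  have hGd : ∀ n, Differentiable ℂ (G n) := by
    intro n
    have : G n = fun z => ∑ k ∈ Finset.range n, P k (v k - G k (p k)) z := funext (hGsum n)
    rw [this]
    exact Differentiable.fun_sum fun k _ => hPd _ _
  have hGv : ∀ k m, k < m → G m (p k) = v k := by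
    intro k m hkm
    induction m, hkm using Nat.le_induction with
    | base => rw [hG, hPk]; ring
    | succ m hm ih => rw [hG, ih, hP0 m _ k hm, add_zero]
  let F : ℂ → ℂ := fun z => ∑' k, P k (v k - G k (p k)) z
  have hlim : ∀ M : ℝ, TendstoUniformlyOn G F atTop (Metric.ball 0 M) := by
    intro M
    have h := tendstoUniformlyOn_tsum_nat_eventually (s := Metric.ball (0 : ℂ) M)
      (f := fun k z => P k (v k - G k (p k)) z) summable_geometric_two (by
        filter_upwards [hinf (2 * M)] with k hk z hz
        refine hPb k _ z (lt_of_le_of_lt ?_ hk)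
        have := mem_ball_zero_iff.1 hz
        linarith)
    have hG' : (fun N x => ∑ n ∈ Finset.range N, P n (v n - G n (p n)) x) = G :=
      funext fun n => funext fun z => (hGsum n z).symm
    rwa [hG'] at h
  refine ⟨F, fun z => ?_, fun k => ?_⟩
  · have hd : DifferentiableOn ℂ F (Metric.ball 0 (‖z‖ + 1)) :=
      (hlim _).tendstoLocallyUniformlyOn.differentiableOn
        (Eventually.of_forall fun n => (hGd n).differentiableOn) Metric.isOpen_ball
    exact hd.differentiableAt (Metric.isOpen_ball.mem_nhds (by simp))
  · have h1 : Tendsto (fun n => G n (p k)) atTop (𝓝 (F (p k))) :=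
      (hlim (‖p k‖ + 1)).tendsto_at (by simp)
    refine tendsto_nhds_unique h1 (tendsto_const_nhds.congr' ?_)
    filter_upwards [eventually_gt_atTop k] with n hn
    exact (hGv k n hn).symm

/-- Interpolation by entire functions on a closed discrete subset of `ℂ`. -/
theorem FiniteInDiscs.exists_entire_eqOn {S : Set ℂ} (hS : FiniteInDiscs S) (v : ℂ → ℂ) :
    ∃ F : ℂ → ℂ, Differentiable ℂ F ∧ Set.EqOn F v S := by
  -- Adjoining the naturals makes the set infinite, so that `ℕ` enumerates it bijectively.
  let T : Set ℂ := S ∪ Set.range ((↑) : ℕ → ℂ)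
  have hT : FiniteInDiscs T := by
    intro M
    refine ((hS M).union ((Set.finite_Iic ⌊M⌋₊).image ((↑) : ℕ → ℂ))).subset ?_
    rintro z ⟨hz | ⟨n, rfl⟩, hM⟩
    · exact Or.inl ⟨hz, hM⟩
    · refine Or.inr ⟨n, ?_, rfl⟩
      rw [Complex.norm_natCast] at hM
      exact Nat.le_floor hM
  have : Countable T := hT.countable.to_subtype
  have : Infinite T := Set.infinite_coe_iff.2
    ((Set.infinite_range_of_injective Nat.cast_injective).mono Set.subset_union_right)
  obtain ⟨e⟩ := nonempty_equiv_of_countable (α := ℕ) (β := T)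
  have hp : Function.Injective fun n => (e n : ℂ) := Subtype.val_injective.comp e.injective
  obtain ⟨F, hF, hFv⟩ := exists_entire_eq_on_sequence (fun n => (e n : ℂ)) hp (fun M => by
    have hfin : {n | ‖(e n : ℂ)‖ ≤ M}.Finite :=
      Set.Finite.of_finite_image ((hT M).subset (by
        rintro _ ⟨n, hn, rfl⟩
        exact ⟨(e n).2, hn⟩)) hp.injOn
    rw [← Nat.cofinite_eq_atTop]
    filter_upwards [hfin.eventually_cofinite_notMem] with n hn
    exact not_le.1 hn) fun n => v (e n)
  refine ⟨F, hF, fun z hz => ?_⟩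
  have h := hFv (e.symm ⟨z, Or.inl hz⟩)
  simpa using h

/-! ### Shears and torus actions as automorphisms of `SL(2, ℂ)` -/

namespace SL2C

theorem det_entries (g : SL(2, ℂ)) : g 0 0 * g 1 1 - g 0 1 * g 1 0 = 1 := by
  have h := g.det_coe
  rwa [Matrix.det_fin_two] at h

theorem ext_entries {g g' : SL(2, ℂ)} (h00 : g 0 0 = g' 0 0) (h01 : g 0 1 = g' 0 1)
    (h10 : g 1 0 = g' 1 0) (h11 : g 1 1 = g' 1 1) : g = g' := by
  apply Subtype.ext
  ext i j
  fin_cases i <;> fin_cases j <;> assumption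

theorem mdifferentiable_entry (i j : Fin 2) :
    MDifferentiable 𝓘(ℂ, ℂ × ℂ × ℂ) 𝓘(ℂ, ℂ) fun g : SL(2, ℂ) => g i j := by
  intro g
  rw [mdifferentiableAt_iff]
  refine ⟨(continuous_entry i j).continuousAt, ?_⟩
  simp only [mfld_simps, differentiableWithinAt_univ, writtenInExtChartAt, extChartAt]
  by_cases h : g 0 0 = 0
  · have hc : chartAt (ℂ × ℂ × ℂ) g = chartSecond := if_pos h
    have h' : g 1 0 ≠ 0 := mem_source_of_eq_zero g h
    rw [hc]
    have hd : DifferentiableAt ℂ (fun p : ℂ × ℂ × ℂ =>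
        (!![p.1, (p.1 * p.2.2 - 1) / p.2.1; p.2.1, p.2.2] : Matrix (Fin 2) (Fin 2) ℂ) i j)
        (chartSecond g) := by
      have h'' : (chartSecond g).2.1 ≠ 0 := h'
      fin_cases i <;> fin_cases j <;> simp <;>
        fun_prop (disch := assumption)
    refine hd.congr_of_eventuallyEq ?_
    filter_upwards [chartSecond.open_target.mem_nhds (chartSecond.map_source h')] with p hp
    exact congrFun (congrFun (coe_ofSecond hp) i) j
  · have hc : chartAt (ℂ × ℂ × ℂ) g = chartFirst := if_neg h
    rw [hc]
    have hd : DifferentiableAt ℂ (fun p : ℂ × ℂ × ℂ =>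
        (!![p.1, p.2.2; p.2.1, (1 + p.2.1 * p.2.2) / p.1] : Matrix (Fin 2) (Fin 2) ℂ) i j)
        (chartFirst g) := by
      have h'' : (chartFirst g).1 ≠ 0 := h
      fin_cases i <;> fin_cases j <;> simp <;>
        fun_prop (disch := assumption)
    refine hd.congr_of_eventuallyEq ?_
    filter_upwards [chartFirst.open_target.mem_nhds (chartFirst.map_source h)] with p hp
    exact congrFun (congrFun (coe_ofFirst hp) i) j

/-- The coordinates of both charts are matrix entries. -/
theorem mdifferentiable_of_entries {φ : SL(2, ℂ) → SL(2, ℂ)}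
    (hφ : ∀ i j, MDifferentiable 𝓘(ℂ, ℂ × ℂ × ℂ) 𝓘(ℂ, ℂ) fun g => φ g i j) :
    MDifferentiable 𝓘(ℂ, ℂ × ℂ × ℂ) 𝓘(ℂ, ℂ × ℂ × ℂ) φ := by
  intro g
  rw [mdifferentiableAt_iff_target]
  constructor
  · have : Continuous φ := Continuous.subtype_mk
      (continuous_pi fun i => continuous_pi fun j => (hφ i j).continuous) _
    exact this.continuousAt
  · simp only [extChartAt, mfld_simps]
    by_cases h : φ g 0 0 = 0
    · have hc : chartAt (ℂ × ℂ × ℂ) (φ g) = chartSecond := if_pos h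
      rw [hc]
      exact (hφ 0 0 g).prodMk_space ((hφ 1 0 g).prodMk_space (hφ 1 1 g))
    · have hc : chartAt (ℂ × ℂ × ℂ) (φ g) = chartFirst := if_neg h
      rw [hc]
      exact (hφ 0 0 g).prodMk_space ((hφ 1 0 g).prodMk_space (hφ 0 1 g))

/-- Addition of `t` times the second column to the first one. -/
def columnShear (t : ℂ) (g : SL(2, ℂ)) : SL(2, ℂ) :=
  ⟨!![g 0 0 + t * g 0 1, g 0 1; g 1 0 + t * g 1 1, g 1 1], by
    rw [Matrix.det_fin_two_of]; linear_combination det_entries g⟩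

/-- Addition of `t` times the second row to the first one. -/
def rowShear (t : ℂ) (g : SL(2, ℂ)) : SL(2, ℂ) :=
  ⟨!![g 0 0 + t * g 1 0, g 0 1 + t * g 1 1; g 1 0, g 1 1], by
    rw [Matrix.det_fin_two_of]; linear_combination det_entries g⟩

/-- Conjugation by a diagonal matrix, multiplying the lower left entry by `exp s`. -/
noncomputable def torusAction (s : ℂ) (g : SL(2, ℂ)) : SL(2, ℂ) :=
  ⟨!![g 0 0, Complex.exp (-s) * g 0 1; Complex.exp s * g 1 0, g 1 1], by
    have h : Complex.exp (-s) * Complex.exp s = 1 := by rw [← Complex.exp_add]; simp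
    rw [Matrix.det_fin_two_of]
    linear_combination det_entries g - g 0 1 * g 1 0 * h⟩

section
variable (t : ℂ) (g : SL(2, ℂ))

@[simp] theorem columnShear_zero_zero : columnShear t g 0 0 = g 0 0 + t * g 0 1 := rfl
@[simp] theorem columnShear_zero_one : columnShear t g 0 1 = g 0 1 := rfl
@[simp] theorem columnShear_one_zero : columnShear t g 1 0 = g 1 0 + t * g 1 1 := rfl
@[simp] theorem columnShear_one_one : columnShear t g 1 1 = g 1 1 := rfl
@[simp] theorem rowShear_zero_zero : rowShear t g 0 0 = g 0 0 + t * g 1 0 := rfl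
@[simp] theorem rowShear_zero_one : rowShear t g 0 1 = g 0 1 + t * g 1 1 := rfl
@[simp] theorem rowShear_one_zero : rowShear t g 1 0 = g 1 0 := rfl
@[simp] theorem rowShear_one_one : rowShear t g 1 1 = g 1 1 := rfl
@[simp] theorem torusAction_zero_zero : torusAction t g 0 0 = g 0 0 := rfl
@[simp] theorem torusAction_zero_one : torusAction t g 0 1 = Complex.exp (-t) * g 0 1 := rfl
@[simp] theorem torusAction_one_zero : torusAction t g 1 0 = Complex.exp t * g 1 0 := rfl
@[simp] theorem torusAction_one_one : torusAction t g 1 1 = g 1 1 := rfl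

end

/-- The column shear with parameter depending on the invariant entry `g 1 1`. -/
def columnShearEquiv (f : ℂ → ℂ) : SL(2, ℂ) ≃ SL(2, ℂ) where
  toFun g := columnShear (f (g 1 1)) g
  invFun g := columnShear (-f (g 1 1)) g
  left_inv g := by apply ext_entries <;> simp
  right_inv g := by apply ext_entries <;> simp

/-- The row shear with parameter depending on the invariant entry `g 1 0`. -/
def rowShearEquiv (f : ℂ → ℂ) : SL(2, ℂ) ≃ SL(2, ℂ) where
  toFun g := rowShear (f (g 1 0)) g
  invFun g := rowShear (-f (g 1 0)) g
  left_inv g := by apply ext_entries <;> simp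
  right_inv g := by apply ext_entries <;> simp

/-- The torus action with parameter depending on the invariant entries `g 0 0` and `g 1 1`. -/
noncomputable def torusEquiv (h : ℂ × ℂ → ℂ) : SL(2, ℂ) ≃ SL(2, ℂ) where
  toFun g := torusAction (h (g 0 0, g 1 1)) g
  invFun g := torusAction (-h (g 0 0, g 1 1)) g
  left_inv g := by apply ext_entries <;> simp [← mul_assoc, ← Complex.exp_add]
  right_inv g := by apply ext_entries <;> simp [← mul_assoc, ← Complex.exp_add]

theorem mdifferentiable_columnShear {t : SL(2, ℂ) → ℂ}
    (ht : MDifferentiable 𝓘(ℂ, ℂ × ℂ × ℂ) 𝓘(ℂ, ℂ) t) :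
    MDifferentiable 𝓘(ℂ, ℂ × ℂ × ℂ) 𝓘(ℂ, ℂ × ℂ × ℂ) fun g => columnShear (t g) g := by
  refine mdifferentiable_of_entries fun i j => ?_
  fin_cases i <;> fin_cases j
  · exact (mdifferentiable_entry 0 0).add (ht.mul (mdifferentiable_entry 0 1))
  · exact mdifferentiable_entry 0 1
  · exact (mdifferentiable_entry 1 0).add (ht.mul (mdifferentiable_entry 1 1))
  · exact mdifferentiable_entry 1 1

theorem mdifferentiable_rowShear {t : SL(2, ℂ) → ℂ}
    (ht : MDifferentiable 𝓘(ℂ, ℂ × ℂ × ℂ) 𝓘(ℂ, ℂ) t) :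
    MDifferentiable 𝓘(ℂ, ℂ × ℂ × ℂ) 𝓘(ℂ, ℂ × ℂ × ℂ) fun g => rowShear (t g) g := by
  refine mdifferentiable_of_entries fun i j => ?_
  fin_cases i <;> fin_cases j
  · exact (mdifferentiable_entry 0 0).add (ht.mul (mdifferentiable_entry 1 0))
  · exact (mdifferentiable_entry 0 1).add (ht.mul (mdifferentiable_entry 1 1))
  · exact mdifferentiable_entry 1 0
  · exact mdifferentiable_entry 1 1

theorem mdifferentiable_torusAction {t : SL(2, ℂ) → ℂ}
    (ht : MDifferentiable 𝓘(ℂ, ℂ × ℂ × ℂ) 𝓘(ℂ, ℂ) t) :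
    MDifferentiable 𝓘(ℂ, ℂ × ℂ × ℂ) 𝓘(ℂ, ℂ × ℂ × ℂ) fun g => torusAction (t g) g := by
  have h1 : Differentiable ℂ fun z : ℂ => Complex.exp (-z) := by fun_prop
  refine mdifferentiable_of_entries fun i j => ?_
  fin_cases i <;> fin_cases j
  · exact mdifferentiable_entry 0 0
  · exact (h1.comp_mdifferentiable ht).mul (mdifferentiable_entry 0 1)
  · exact (Complex.differentiable_exp.comp_mdifferentiable ht).mul (mdifferentiable_entry 1 0)
  · exact mdifferentiable_entry 1 1

theorem isHolomorphicAutomorphism_columnShearEquiv {f : ℂ → ℂ} (hf : Differentiable ℂ f) :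
    IsHolomorphicAutomorphism (ℂ × ℂ × ℂ) (columnShearEquiv f) :=
  ⟨mdifferentiable_columnShear (hf.comp_mdifferentiable (mdifferentiable_entry 1 1)),
    mdifferentiable_columnShear (hf.neg.comp_mdifferentiable (mdifferentiable_entry 1 1))⟩

theorem isHolomorphicAutomorphism_rowShearEquiv {f : ℂ → ℂ} (hf : Differentiable ℂ f) :
    IsHolomorphicAutomorphism (ℂ × ℂ × ℂ) (rowShearEquiv f) :=
  ⟨mdifferentiable_rowShear (hf.comp_mdifferentiable (mdifferentiable_entry 1 0)),
    mdifferentiable_rowShear (hf.neg.comp_mdifferentiable (mdifferentiable_entry 1 0))⟩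

theorem isHolomorphicAutomorphism_torusEquiv {h : ℂ × ℂ → ℂ} (hh : Differentiable ℂ h) :
    IsHolomorphicAutomorphism (ℂ × ℂ × ℂ) (torusEquiv h) := by
  have hd : MDifferentiable 𝓘(ℂ, ℂ × ℂ × ℂ) 𝓘(ℂ, ℂ × ℂ) fun g : SL(2, ℂ) => (g 0 0, g 1 1) :=
    fun g => (mdifferentiable_entry 0 0 g).prodMk_space (mdifferentiable_entry 1 1 g)
  exact ⟨mdifferentiable_torusAction (hh.comp_mdifferentiable hd),
    mdifferentiable_torusAction (hh.neg.comp_mdifferentiable hd)⟩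

/-- Row shears with large parameter leave every compact set, if the second row does not start
with zero. -/
theorem eventually_le_rowShear {ρ : SL(2, ℂ) → ℝ≥0} (hρ : IsExhaustionFunction ρ) (r : ℝ≥0)
    {g : SL(2, ℂ)} (hg : g 1 0 ≠ 0) :
    ∀ᶠ t in Bornology.cobounded ℂ, r ≤ ρ (rowShear t g) := by
  obtain ⟨B, hB⟩ := (hρ.2 r).exists_bound_of_continuousOn (continuous_entry 0 0).continuousOn
  have hg' : 0 < ‖g 1 0‖ := norm_pos_iff.2 hg
  filter_upwards [tendsto_norm_cobounded_atTop.eventually_gt_atTop ((B + ‖g 0 0‖) / ‖g 1 0‖)]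
    with t ht
  by_contra! hlt
  have h1 := hB (rowShear t g) hlt.le
  rw [div_lt_iff₀ hg', ← norm_mul] at ht
  have h2 : t * g 1 0 = rowShear t g 0 0 - g 0 0 := by simp
  have h3 := norm_sub_le (rowShear t g 0 0) (g 0 0)
  rw [← h2] at h3
  linarith

end SL2C

theorem IsHolomorphicAutomorphism.trans {E : Type*} [NormedAddCommGroup E] [NormedSpace ℂ E]
    {X : Type*} [TopologicalSpace X] [ChartedSpace E X] {φ ψ : X ≃ X}
    (hφ : IsHolomorphicAutomorphism E φ) (hψ : IsHolomorphicAutomorphism E ψ) :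
    IsHolomorphicAutomorphism E (φ.trans ψ) :=
  ⟨hψ.1.comp hφ.1, hφ.2.comp hψ.2⟩

/-! ### Discrete subrings of `ℂ` and matrices over them -/

/-- Otherwise the powers of `z` would be infinitely many ring elements in the unit disc. -/
theorem FiniteInDiscs.one_le_norm {S : Subring ℂ} (hS : FiniteInDiscs (S : Set ℂ)) {z : ℂ}
    (hz : z ∈ S) (h0 : z ≠ 0) : 1 ≤ ‖z‖ := by
  by_contra! h
  refine Set.infinite_range_of_injective (f := fun n : ℕ => z ^ n) (fun m n hmn => ?_)
    ((hS 1).subset ?_)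
  · exact pow_right_injective₀ (norm_pos_iff.2 h0) h.ne
      (by simpa only [norm_pow] using congrArg norm hmn)
  · rintro _ ⟨n, rfl⟩
    exact ⟨pow_mem hz n, by rw [norm_pow]; exact pow_le_one₀ (norm_nonneg z) h.le⟩

theorem FiniteInDiscs.one_le_dist {S : Subring ℂ} (hS : FiniteInDiscs (S : Set ℂ)) {z w : ℂ}
    (hz : z ∈ S) (hw : w ∈ S) (h : z ≠ w) : 1 ≤ dist z w := by
  rw [dist_eq_norm]
  exact hS.one_le_norm (sub_mem hz hw) (sub_ne_zero.2 h)

namespace SL2C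

/-- The matrices in `SL(2, ℂ)` with all entries in `S`. -/
def withEntriesIn (S : Set ℂ) : Set SL(2, ℂ) := {g | ∀ i j, g i j ∈ S}

theorem isClosed_withEntriesIn {S : Subring ℂ} (hS : FiniteInDiscs (S : Set ℂ)) :
    IsClosed (withEntriesIn S) := by
  have h : IsClosed (S : Set ℂ) :=
    Metric.isClosed_of_pairwise_le_dist one_pos fun z hz w hw hzw => hS.one_le_dist hz hw hzw
  simp only [withEntriesIn, Set.ofPred_forall]
  exact isClosed_iInter fun i => isClosed_iInter fun j => h.preimage (continuous_entry i j)

theorem isDiscrete_withEntriesIn {S : Subring ℂ} (hS : FiniteInDiscs (S : Set ℂ)) :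
    IsDiscrete (withEntriesIn S) := by
  refine IsDiscrete.of_nhdsWithin fun g hg => ?_
  rw [le_pure_iff]
  have h : ∀ᶠ g' in 𝓝 g, ∀ i j, g' i j ∈ Metric.ball (g i j) 1 := by
    refine eventually_all.2 fun i => eventually_all.2 fun j => ?_
    exact (continuous_entry i j).continuousAt (Metric.ball_mem_nhds _ one_pos)
  filter_upwards [nhdsWithin_le_nhds h, self_mem_nhdsWithin] with g' h1 h2
  have he : ∀ i j, g' i j = g i j := fun i j => by
    by_contra hne
    exact absurd (Metric.mem_ball.1 (h1 i j)) (not_lt.2 (hS.one_le_dist (h2 i j) (hg i j) hne))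
  exact ext_entries (he 0 0) (he 0 1) (he 1 0) (he 1 1)

/-- For the matrices with entries in a discrete subring there is a holomorphic automorphism of
`SL(2, ℂ)` after which the lower left entry does not vanish and is proper. -/
theorem exists_automorphism_proper_entry {S : Subring ℂ} (hS : FiniteInDiscs (S : Set ℂ)) :
    ∃ ψ : SL(2, ℂ) ≃ SL(2, ℂ), IsHolomorphicAutomorphism (ℂ × ℂ × ℂ) ψ ∧
      (∀ g ∈ withEntriesIn S, ψ g 1 0 ≠ 0) ∧
      ∀ M : ℝ, {g | g ∈ withEntriesIn S ∧ ‖ψ g 1 0‖ ≤ M}.Finite := by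
  -- The values at `0` keep `2 * q * f = 1` on all of `S`. Thus `q` clears the denominator of `f`,
  -- and the sheared entries become elements of `S`, where `H` is the norm.
  obtain ⟨q, hq, hqS⟩ := hS.exists_entire_eqOn fun z => if z = 0 then 1 else z
  obtain ⟨f, hf, hfS⟩ := hS.exists_entire_eqOn fun z => if z = 0 then 1 / 2 else 1 / (2 * z)
  obtain ⟨H, hH, hHS⟩ := hS.exists_entire_eqOn fun z => (‖z‖ : ℂ)
  have hq0 : q 0 = 1 := by simpa using hqS S.zero_mem
  have hq1 : ∀ z ∈ S, z ≠ 0 → q z = z := fun z hz h => by simpa [h] using hqS hz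
  have hf1 : ∀ z ∈ S, z ≠ 0 → z * f z = 1 / 2 := fun z hz h => by
    have : f z = 1 / (2 * z) := by simpa [h] using hfS hz
    rw [this]; field_simp
  have hqmem : ∀ z ∈ S, q z ∈ S := fun z hz => by
    by_cases h : z = 0
    · rw [h, hq0]; exact S.one_mem
    · rwa [hq1 z hz h]
  have hqf : ∀ z ∈ S, 2 * (q z * f z) = 1 := fun z hz => by
    by_cases h : z = 0
    · have : f 0 = 1 / 2 := by simpa using hfS S.zero_mem
      rw [h, hq0, this]; norm_num
    · rw [hq1 z hz h, hf1 z hz h]; norm_num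
  have h2S : (2 : ℂ) ∈ S := ofNat_mem S 2
  -- `-1/2` has norm less than `1`, so it is not in `S`.
  have hodd : ∀ c ∈ S, 2 * c + 1 ≠ 0 := fun c hc h => by
    have hc' : c = -1 / 2 := by linear_combination h / 2
    have h1 := hS.one_le_norm hc (by rw [hc']; norm_num)
    rw [hc'] at h1
    norm_num at h1
  -- After the column shear, `x` is `2 * q d` times the upper left entry and `y` is twice the lower
  -- left entry.
  let x : SL(2, ℂ) → ℂ := fun g => 2 * q (g 1 1) * g 0 0 + g 0 1
  let y : SL(2, ℂ) → ℂ := fun g => 2 * g 1 0 + 2 * (g 1 1 * f (g 1 1))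
  let h : ℂ × ℂ → ℂ := fun p => H (2 * q p.2 * p.1) + H p.2
  have hh : Differentiable ℂ h := by unfold h; fun_prop
  let ψ := (columnShearEquiv f).trans (torusEquiv h)
  have hxS : ∀ g ∈ withEntriesIn S, x g ∈ S := fun g hg =>
    S.add_mem (S.mul_mem (S.mul_mem h2S (hqmem _ (hg 1 1))) (hg 0 0)) (hg 0 1)
  have hy : ∀ g ∈ withEntriesIn S, y g ∈ S ∧ y g ≠ 0 := fun g hg => by
    by_cases hd : g 1 1 = 0
    · have hdet := det_entries g
      rw [hd] at hdet
      have hyg : y g = 2 * g 1 0 := by simp [y, hd]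
      rw [hyg]
      refine ⟨S.mul_mem h2S (hg 1 0), mul_ne_zero two_ne_zero fun hc => ?_⟩
      rw [hc] at hdet
      norm_num at hdet
    · have hyg : y g = 2 * g 1 0 + 1 := by
        simp only [y, hf1 _ (hg 1 1) hd]; norm_num
      rw [hyg]
      exact ⟨S.add_mem (S.mul_mem h2S (hg 1 0)) S.one_mem, hodd _ (hg 1 0)⟩
  have hψ : ∀ g ∈ withEntriesIn S,
      ψ g 1 0 = Complex.exp ((‖x g‖ + ‖g 1 1‖ : ℝ) : ℂ) * (y g / 2) := fun g hg => by
    have h1 : 2 * q (g 1 1) * (g 0 0 + f (g 1 1) * g 0 1) = x g := by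
      simp only [x]
      linear_combination g 0 1 * hqf _ (hg 1 1)
    have h2 : g 1 0 + f (g 1 1) * g 1 1 = y g / 2 := by simp only [y]; ring
    change Complex.exp (H (2 * q (g 1 1) * (g 0 0 + f (g 1 1) * g 0 1)) + H (g 1 1)) *
      (g 1 0 + f (g 1 1) * g 1 1) = _
    rw [h1, h2, hHS (hxS g hg), hHS (hg 1 1), Complex.ofReal_add]
  refine ⟨ψ, (isHolomorphicAutomorphism_columnShearEquiv hf).trans
    (isHolomorphicAutomorphism_torusEquiv hh), fun g hg => ?_, fun M => ?_⟩
  · rw [hψ g hg]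
    exact mul_ne_zero (Complex.exp_ne_zero _) (div_ne_zero (hy g hg).2 two_ne_zero)
  have hfin := (hS (2 * M)).prod ((hS (2 * M)).prod (hS (2 * M)))
  -- A bound on `exp (‖x‖ + ‖d‖) * ‖y‖ / 2` with `‖y‖ ≥ 1` leaves finitely many triples `(d, x, y)`,
  -- and the triple determines the matrix.
  refine Set.Finite.of_finite_image (f := fun g => (g 1 1, x g, y g)) (hfin.subset ?_) ?_
  · rintro _ ⟨g, ⟨hg, hM⟩, rfl⟩
    rw [hψ g hg, norm_mul, Complex.norm_exp, Complex.ofReal_re, norm_div, Complex.norm_two] at hM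
    have hx0 := norm_nonneg (x g)
    have hd0 := norm_nonneg (g 1 1)
    have h1 := hS.one_le_norm (hy g hg).1 (hy g hg).2
    have h2 := Real.add_one_le_exp (‖x g‖ + ‖g 1 1‖)
    have h3 : Real.exp (‖x g‖ + ‖g 1 1‖) ≤ 2 * M := by nlinarith
    have h4 : ‖y g‖ ≤ 2 * M := by nlinarith
    exact ⟨⟨hg 1 1, by linarith⟩, ⟨hxS g hg, by linarith⟩, (hy g hg).1, h4⟩
  · rintro g ⟨hg, -⟩ g' ⟨hg', -⟩ heq
    simp only [Prod.mk.injEq] at heq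
    obtain ⟨hd, hx, hy'⟩ := heq
    have hc : g 1 0 = g' 1 0 := by
      simp only [y, hd] at hy'
      linear_combination hy' / 2
    have hdet := det_entries g
    have hdet' := det_entries g'
    simp only [x] at hx
    rw [hc, hd] at hdet
    rw [hd] at hx
    by_cases h0 : g' 1 1 = 0
    · rw [h0, hq0] at hx
      rw [h0] at hdet hdet'
      have hc0 : g' 1 0 ≠ 0 := fun h => by rw [h] at hdet'; norm_num at hdet'
      have hb : g 0 1 = g' 0 1 := mul_right_cancel₀ hc0 (by linear_combination hdet' - hdet)
      exact ext_entries (by linear_combination (hx - hb) / 2) hb hc hd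
    · rw [hq1 _ (hg' 1 1) h0] at hx
      -- Eliminating `a` from `2 * d * a + b = x` and `a * d - b * c = 1` gives `(2 * c + 1) * b = x
      -- - 2`.
      have hb : g 0 1 = g' 0 1 := mul_right_cancel₀ (hodd _ (hg' 1 0))
        (by linear_combination hx - 2 * (hdet - hdet'))
      have ha : g 0 0 = g' 0 0 := mul_right_cancel₀ h0
        (by linear_combination hdet - hdet' + g' 1 0 * hb)
      exact ext_entries ha hb hc hd

theorem exists_automorphism_le_exhaustion {S : Subring ℂ} (hS : FiniteInDiscs (S : Set ℂ))
    {ρ : SL(2, ℂ) → ℝ≥0} (hρ : IsExhaustionFunction ρ) (ζ : withEntriesIn (S : Set ℂ) → ℝ≥0) :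
    ∃ φ : SL(2, ℂ) ≃ SL(2, ℂ), IsHolomorphicAutomorphism (ℂ × ℂ × ℂ) φ ∧
      ∀ g : withEntriesIn (S : Set ℂ), ζ g ≤ ρ (φ g) := by
  obtain ⟨ψ, hψ, hψ0, hψfin⟩ := exists_automorphism_proper_entry hS
  let W : Set ℂ := (fun g => ψ g 1 0) '' withEntriesIn (S : Set ℂ)
  have hW : FiniteInDiscs W := fun M => by
    refine ((hψfin M).image fun g => ψ g 1 0).subset ?_
    rintro _ ⟨⟨g, hg, rfl⟩, hM⟩
    exact ⟨g, ⟨hg, hM⟩, rfl⟩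
  -- One parameter must serve the whole fibre over `w`; the fibre is finite, so a large enough one
  -- does.
  have ht : ∀ w : ℂ, ∃ t : ℂ, ∀ g : withEntriesIn (S : Set ℂ), ψ g 1 0 = w →
      ζ g ≤ ρ (rowShear t (ψ g)) := fun w => by
    have hfin : {g : withEntriesIn (S : Set ℂ) | ψ g 1 0 = w}.Finite := by
      refine Set.Finite.of_finite_image (f := Subtype.val) ((hψfin ‖w‖).subset ?_)
        Subtype.val_injective.injOn
      rintro _ ⟨g, hg, rfl⟩
      exact ⟨g.2, (congrArg norm hg).le⟩
    exact ((eventually_all_finite hfin).2 fun g _ =>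
      eventually_le_rowShear hρ (ζ g) (hψ0 g g.2)).exists
  choose t ht using ht
  obtain ⟨F, hF, hFW⟩ := hW.exists_entire_eqOn t
  refine ⟨ψ.trans (rowShearEquiv F), hψ.trans (isHolomorphicAutomorphism_rowShearEquiv hF),
    fun g => ?_⟩
  change ζ g ≤ ρ (rowShear (F (ψ g 1 0)) (ψ g))
  rw [hFW ⟨g, g.2, rfl⟩]
  exact ht _ g rfl

theorem infinite_withEntriesIn (S : Subring ℂ) : (withEntriesIn (S : Set ℂ)).Infinite := by
  refine Set.infinite_of_injective_forall_mem (f := fun n : ℕ => rowShear n 1) (fun m n h => ?_)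
    fun n i j => ?_
  · have h' : rowShear (m : ℂ) 1 0 1 = rowShear (n : ℂ) 1 0 1 := by
      simp only at h
      rw [h]
    simpa using h'
  · have h1 : ∀ i j, (1 : SL(2, ℂ)) i j ∈ (S : Set ℂ) := fun i j => by
      fin_cases i <;> fin_cases j <;> simp
    have hn := natCast_mem S n
    fin_cases i <;> fin_cases j
    · exact S.add_mem (h1 0 0) (S.mul_mem hn (h1 1 0))
    · exact S.add_mem (h1 0 1) (S.mul_mem hn (h1 1 1))
    · exact h1 1 0
    · exact h1 1 1

theorem isTameDiscrete_withEntriesIn {S : Subring ℂ} (hS : FiniteInDiscs (S : Set ℂ)) :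
    IsTameDiscrete (ℂ × ℂ × ℂ) (withEntriesIn (S : Set ℂ)) :=
  ⟨infinite_withEntriesIn S, isClosed_withEntriesIn hS, isDiscrete_withEntriesIn hS,
    fun _ hρ ζ => exists_automorphism_le_exhaustion hS hρ ζ⟩

end SL2C

/-! ### Rings of integers and Gaussian integers -/

theorem sl2Image_eq_withEntriesIn {R : Type*} [CommRing R] {σ : R →+* ℂ}
    (hσ : Function.Injective σ) : sl2Image σ = SL2C.withEntriesIn (σ.range : Set ℂ) := by
  ext g
  constructor
  · rintro ⟨g, rfl⟩ i j
    exact ⟨g i j, rfl⟩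
  · intro hg
    choose A hA using hg
    have hmap : σ.mapMatrix (Matrix.of A) = (g : Matrix (Fin 2) (Fin 2) ℂ) := by
      ext i j
      exact hA i j
    refine ⟨⟨Matrix.of A, hσ ?_⟩, Subtype.ext hmap⟩
    rw [RingHom.map_det, hmap, g.det_coe, map_one]

theorem isTameDiscrete_sl2Image {R : Type*} [CommRing R] {σ : R →+* ℂ}
    (hσ : Function.Injective σ) (hfin : ∀ M : ℝ, {r | ‖σ r‖ ≤ M}.Finite) :
    IsTameDiscrete (ℂ × ℂ × ℂ) (sl2Image σ) := by
  rw [sl2Image_eq_withEntriesIn hσ]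
  refine SL2C.isTameDiscrete_withEntriesIn fun M => ((hfin M).image σ).subset ?_
  rintro _ ⟨⟨r, rfl⟩, hM⟩
  exact ⟨r, hM, rfl⟩

/-- Under `hσ` all embeddings have the same absolute value, so a bound on `‖σ r‖` bounds every
conjugate of the algebraic integer `r`, leaving finitely many. -/
theorem isTameDiscrete_sl2Image_ringOfIntegers {K : Type*} [Field K] [NumberField K]
    (σ : K →+* ℂ) (hσ : ∀ τ : K →+* ℂ, τ = σ ∨ τ = NumberField.ComplexEmbedding.conjugate σ) :
    IsTameDiscrete (ℂ × ℂ × ℂ) (sl2Image (σ.comp (algebraMap (𝓞 K) K))) := by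
  have hinj : Function.Injective (algebraMap (𝓞 K) K) := NumberField.RingOfIntegers.coe_injective
  refine isTameDiscrete_sl2Image (σ.injective.comp hinj) fun M => ?_
  refine Set.Finite.of_finite_image (f := algebraMap (𝓞 K) K)
    ((NumberField.Embeddings.finite_of_norm_le K ℂ M).subset ?_) hinj.injOn
  rintro _ ⟨r, hr, rfl⟩
  refine ⟨NumberField.RingOfIntegers.isIntegral_coe r, fun τ => ?_⟩
  obtain rfl | rfl := hσ τ
  · exact hr
  · rw [NumberField.ComplexEmbedding.conjugate_coe_eq, Complex.norm_conj]
    exact hr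

theorem NumberField.eq_or_eq_conjugate_of_finrank_eq_two {K : Type*} [Field K] [NumberField K]
    [NumberField.IsTotallyComplex K] (hK : Module.finrank ℚ K = 2) (σ τ : K →+* ℂ) :
    τ = σ ∨ τ = ComplexEmbedding.conjugate σ := by
  classical
  have hne : σ ≠ ComplexEmbedding.conjugate σ := fun h =>
    IsTotallyComplex.complexEmbedding_not_isReal σ (ComplexEmbedding.isReal_iff.2 h.symm)
  have hcard : ({σ, ComplexEmbedding.conjugate σ} : Finset (K →+* ℂ)).card =
      Fintype.card (K →+* ℂ) := by
    rw [Finset.card_pair hne, NumberField.Embeddings.card, hK]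
  have h := Finset.mem_univ τ
  rw [← (Finset.card_eq_iff_eq_univ _).1 hcard] at h
  simpa using h

theorem GaussianInt.finite_norm_toComplex_le (M : ℝ) :
    {r : GaussianInt | ‖GaussianInt.toComplex r‖ ≤ M}.Finite := by
  have hI : (Set.Icc (-⌊M⌋) ⌊M⌋).Finite := Set.finite_Icc _ _
  refine ((hI.prod hI).image fun p : ℤ × ℤ => (⟨p.1, p.2⟩ : GaussianInt)).subset fun r hr => ?_
  have h : ∀ n : ℤ, |(n : ℝ)| ≤ M → n ∈ Set.Icc (-⌊M⌋) ⌊M⌋ := fun n hn => by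
    rw [Set.mem_Icc, ← abs_le]
    exact Int.le_floor.2 (by exact_mod_cast hn)
  refine ⟨(r.re, r.im), ⟨h _ ?_, h _ ?_⟩, rfl⟩
  · rw [GaussianInt.intCast_re]
    exact (Complex.abs_re_le_norm _).trans hr
  · rw [GaussianInt.intCast_im]
    exact (Complex.abs_im_le_norm _).trans hr

theorem mainTheorem7 :
    IsTameDiscrete (ℂ × ℂ × ℂ) (sl2Image ((algebraMap ℚ ℂ).comp (algebraMap (𝓞 ℚ) ℚ))) ∧
    (∀ (K : Type*) [Field K] [NumberField K] [NumberField.IsTotallyComplex K],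
      Module.finrank ℚ K = 2 → ∀ σ : K →+* ℂ,
        IsTameDiscrete (ℂ × ℂ × ℂ) (sl2Image (σ.comp (algebraMap (𝓞 K) K)))) ∧
    IsTameDiscrete (ℂ × ℂ × ℂ) (sl2Image GaussianInt.toComplex) := by
  refine ⟨?_, ?_, ?_⟩
  · exact isTameDiscrete_sl2Image_ringOfIntegers _ fun τ => Or.inl (Subsingleton.elim _ _)
  · intro K _ _ _ hK σ
    exact isTameDiscrete_sl2Image_ringOfIntegers σ
      (NumberField.eq_or_eq_conjugate_of_finrank_eq_two hK σ)
  · exact isTameDiscrete_sl2Image (fun _ _ h => GaussianInt.toComplex_inj.1 h)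
      GaussianInt.finite_norm_toComplex_le
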